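/- Let $(a_0(n))_{n\ge1}$ and $(a_1(n))_{n\ge1}$ be real sequences with $2a_0(n)+a_1(n)=1$ for all $n\ge 1$, such that the limit $L_1:=\lim_{n\to\infty}a_1(n)\in\mathbb R$ exists. Put $a(x,n):=a_1(n)x+a_0(n)$ and, for $x\in[0,1]$, $p_{n,k}(x):=\binom nk x^k(1-x)^{n-k}$ for $0\le k\le n$. For $n\ge 1$ and $x\in[0,1]$ let $$p_{n,0}^{M,1}(x):=a(x,n)(1-x)^{n-1},\qquad p_{n,n}^{M,1}(x):=a(1-x,n)x^{n-1},$$ $$p_{n,k}^{M,1}(x):=a(x,n)p_{n-1,k}(x)+a(1-x,n)p_{n-1,k-1}(x)\quad(1\le k\le n-1),$$ and let $B_n^{M,1}(f;x):=\sum_{k=0}^n p_{n,k}^{M,1}(x)\,f(k/n)$ be the modified Bernstein operator. For a bounded function $g$ on $[0,1]$ and $\delta>0$ let $\|g\|_\infty:=\sup_{t\in[0,1]}|g(t)|$ and $$\omega_1(g;\delta):=\sup\{|g(s)-g(t)|: s,t\in[0,1],\ |s-t|\le\delta\},$$ $$\omega_2(g;\delta):=\sup\{|g(t+h)-2g(t)+g(t-h)|: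 0\le h\le\delta,\ t\pm h\in[0,1]\}.$$ **Theorem.** Let $f\in C^2[0,1]$. Then for all $n\ge1$ and $x\in[0,1]$, with $X:=x(1-x)$ and $X':=1-2x$, $$\begin{aligned} \Delta_n^B&:=\left|n\left[B_n^{M,1}(f;x)-f(x)\right]-\frac{X}{2}f''(x)-\frac{X'}{2}(1+L_1)f'(x)\right|\\ &\le X\left\{\frac56\,\frac{|X'|}{\sqrt{3(n-2)X+1}}\;\omega_1\!\left(f'';\sqrt{\frac{3(n-2)X+1}{n^2}}\right)+\frac{13}{16}\,\omega_2\!\left(f'';\sqrt{\frac{3(n-2)X+1}{n^2}}\right)\right\}\\ &\quad+\frac{|X'|}{2}\left\{|L_1-a_1(n)|\cdot\|f'\|_\infty+|1+L_1|\left(\frac{13}{4}\,\omega_2\!\left(f';\frac1{\sqrt n}\right)+\frac1{\sqrt n}\,\omega_1\!\left(f';\frac1{\sqrt n}\right)\right)\right\}. \end{aligned}$$ -/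

import Mathlib

open Set Filter Topology

noncomputable section

/-- The perturbed coefficient `a(x, n) = a₁(n) x + a₀(n)`. -/
def perturbCoeff (a₀ a₁ : ℕ → ℝ) (x : ℝ) (n : ℕ) : ℝ := a₁ n * x + a₀ n

/-- The modified fundamental function `p_{n,k}^{M,1}(x)`, for `n ≥ 1` and `0 ≤ k ≤ n`.  Here
`(bernsteinPolynomial ℝ m j).eval x` is `p_{m,j}(x) = (m choose j) x^j (1 - x)^(m - j)`. -/
def modBernsteinBasis (a₀ a₁ : ℕ → ℝ) (n k : ℕ) (x : ℝ) : ℝ :=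
  if k = 0 then perturbCoeff a₀ a₁ x n * (1 - x) ^ (n - 1)
  else if k = n then perturbCoeff a₀ a₁ (1 - x) n * x ^ (n - 1)
  else perturbCoeff a₀ a₁ x n * (bernsteinPolynomial ℝ (n - 1) k).eval x
    + perturbCoeff a₀ a₁ (1 - x) n * (bernsteinPolynomial ℝ (n - 1) (k - 1)).eval x

/-- The modified Bernstein operator `B_n^{M,1}(f; x) = ∑_{k=0}^n p_{n,k}^{M,1}(x) f(k/n)`. -/
def modBernstein (a₀ a₁ : ℕ → ℝ) (n : ℕ) (f : ℝ → ℝ) (x : ℝ) : ℝ :=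
  ∑ k ∈ Finset.range (n + 1), modBernsteinBasis a₀ a₁ n k x * f ((k : ℝ) / (n : ℝ))

/-- The first order modulus of continuity on `[0, 1]`. -/
def omega1 (g : ℝ → ℝ) (δ : ℝ) : ℝ :=
  sSup {r : ℝ | ∃ s ∈ Icc (0 : ℝ) 1, ∃ t ∈ Icc (0 : ℝ) 1, |s - t| ≤ δ ∧ r = |g s - g t|}

/-- The second order modulus of smoothness on `[0, 1]`. -/
def omega2 (g : ℝ → ℝ) (δ : ℝ) : ℝ :=
  sSup {r : ℝ | ∃ t h : ℝ, 0 ≤ h ∧ h ≤ δ ∧ t - h ∈ Icc (0 : ℝ) 1 ∧ t + h ∈ Icc (0 : ℝ) 1 ∧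
    r = |g (t + h) - 2 * g t + g (t - h)|}

/-- The supremum norm on `[0, 1]`. -/
def supNorm (g : ℝ → ℝ) : ℝ :=
  sSup {r : ℝ | ∃ t ∈ Icc (0 : ℝ) 1, r = |g t|}

end

/-! Let B_n be the classical Bernstein operator. The normalization gives a(x,n) = (1-x) -
(X'/2)(1+a₁(n)) and a(1-x,n) = x + (X'/2)(1+a₁(n)), hence n B_n^{M,1} f = n B_n f + (X'/2)(1+a₁(n))
(B_n f)' (`modBernstein_eq`). What remains is a Voronovskaya estimate for B_n and two bounds on (B_n
f)': its size, and its distance from f'(x).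

The quantitative input is `exists_slope`: a continuous g is approximated by a line through (x, g(x))
with error ω₂(g;h)(1 + 3(s-x)²/h²) and a slope c satisfying |c|h ≤ ω₁ + ω₂. It is applied to f'' and
to f', then integrated twice or once by monotonicity. Averaging over binomial weights leaves only
central moments of order at most four.

In the Voronovskaya part the slope of f'' meets the third central moment, whence the factor X'. The
fourth central moment of k/n is (3(n-2)X+1)/n² times the second, so for n ≥ 2 the square root of
this factor is the natural step h. Small n, where the natural step may exceed 1/2, need a step of
1/2. -/

/-! ### Lines fitted to functions with small second differences -/

/-- Where the scaled chord error φ is largest in modulus, reflect the nearer endpoint, a zero of φ,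
through that point: the second difference yields 2|φ| ≤ w(b-a) + |φ|. -/
theorem interpolation_error_le {g : ℝ → ℝ} {a b w : ℝ} (hab : a < b)
    (hg : ContinuousOn g (Icc a b))
    (hw : ∀ t k : ℝ, t - k ∈ Icc a b → t + k ∈ Icc a b →
      |g (t + k) - 2 * g t + g (t - k)| ≤ w)
    {q : ℝ} (hq : q ∈ Icc a b) :
    |(b - q) * g a + (q - a) * g b - (b - a) * g q| ≤ w * (b - a) := by
  have hba : 0 < b - a := sub_pos.2 hab
  set φ : ℝ → ℝ := fun y => (b - y) * g a + (y - a) * g b - (b - a) * g y with hφ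
  have hc : ContinuousOn (fun y => |φ y|) (Icc a b) := by
    apply ContinuousOn.abs
    simp only [hφ]
    fun_prop
  obtain ⟨y, hy, hmax⟩ := isCompact_Icc.exists_isMaxOn ⟨a, left_mem_Icc.2 hab.le⟩ hc
  have hmax' : ∀ z ∈ Icc a b, |φ z| ≤ |φ y| := fun z hz => hmax hz
  suffices h : |φ y| ≤ w * (b - a) from (hmax' q hq).trans h
  have hd : ∀ k, y - k ∈ Icc a b → y + k ∈ Icc a b →
      |φ (y + k) - 2 * φ y + φ (y - k)| ≤ w * (b - a) := by
    intro k h1 h2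
    have : φ (y + k) - 2 * φ y + φ (y - k)
        = -((g (y + k) - 2 * g y + g (y - k)) * (b - a)) := by
      simp only [hφ]; ring
    rw [this, abs_neg, abs_mul, abs_of_pos hba]
    exact mul_le_mul_of_nonneg_right (hw y k h1 h2) hba.le
  have ha0 : φ a = 0 := by simp only [hφ]; ring
  have hb0 : φ b = 0 := by simp only [hφ]; ring
  rcases le_total y ((a + b) / 2) with h | h
  · have h2 : y + (y - a) ∈ Icc a b := ⟨by linarith [hy.1], by linarith⟩
    have h3 := hd (y - a) (by simpa using hab.le) h2
    have h4 := hmax' _ h2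
    rw [sub_sub_cancel, ha0] at h3
    rw [abs_le] at h3 h4
    rcases abs_cases (φ y) with h5 | h5 <;> linarith
  · have h2 : y - (b - y) ∈ Icc a b := ⟨by linarith, by linarith [hy.2]⟩
    have h3 := hd (b - y) h2 (by simpa using hab.le)
    have h4 := hmax' _ h2
    rw [add_sub_cancel, hb0] at h3
    rw [abs_le] at h3 h4
    rcases abs_cases (φ y) with h5 | h5 <;> linarith

/-- Each s ≠ x confines c to the interval [l s, r s]. Chord interpolation on s, s', x makes these
intervals meet pairwise, so they share a point (Helly on the line), the supremum of the left
endpoints. -/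
theorem exists_slope_of_second_difference {g : ℝ → ℝ} {a b w x : ℝ} (hx : x ∈ Icc a b)
    (hg : ContinuousOn g (Icc a b))
    (hw : ∀ t k : ℝ, t - k ∈ Icc a b → t + k ∈ Icc a b →
      |g (t + k) - 2 * g t + g (t - k)| ≤ w) :
    ∃ c : ℝ, ∀ s ∈ Icc a b, |g s - g x - c * (s - x)| ≤ w := by
  have hint : ∀ p q r : ℝ, p ∈ Icc a b → r ∈ Icc a b → p < q → q < r →
      |(r - q) * (g p - g x) + (q - p) * (g r - g x) - (r - p) * (g q - g x)|
        ≤ w * (r - p) := by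
    intro p q r hp hr hpq hqr
    have hsub : Icc p r ⊆ Icc a b := Icc_subset_Icc hp.1 hr.2
    have := interpolation_error_le (hpq.trans hqr) (hg.mono hsub)
      (fun t k h1 h2 => hw t k (hsub h1) (hsub h2)) ⟨hpq.le, hqr.le⟩
    rwa [show (r - q) * (g p - g x) + (q - p) * (g r - g x) - (r - p) * (g q - g x)
      = (r - q) * g p + (q - p) * g r - (r - p) * g q by ring]
  have hw0 : 0 ≤ w := (abs_nonneg _).trans (hw x 0 (by simpa using hx) (by simpa using hx))
  set l : ℝ → ℝ := fun s => (g s - g x) / (s - x) - w / |s - x| with hl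
  set r : ℝ → ℝ := fun s => (g s - g x) / (s - x) + w / |s - x| with hr
  have key : ∀ s ∈ Icc a b, s ≠ x → ∀ s' ∈ Icc a b, s' ≠ x → l s ≤ r s' := by
    intro s hs hsx s' hs' hsx'
    have hslope : |(g s - g x) * (s' - x) - (g s' - g x) * (s - x)|
        ≤ w * (|s - x| + |s' - x|) := by
      rcases lt_or_gt_of_ne hsx with h1 | h1 <;> rcases lt_or_gt_of_ne hsx' with h2 | h2
      · rw [abs_of_neg (sub_neg.2 h1), abs_of_neg (sub_neg.2 h2)]
        rcases lt_trichotomy s s' with h3 | rfl | h3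
        · have := hint s s' x hs hx h3 h2
          rw [abs_le] at this ⊢
          constructor <;> nlinarith [mul_nonneg hw0 (sub_pos.2 h2).le]
        · rw [sub_self, abs_zero]; nlinarith [mul_nonneg hw0 (sub_pos.2 h2).le]
        · have := hint s' s x hs' hx h3 h1
          rw [abs_le] at this ⊢
          constructor <;> nlinarith [mul_nonneg hw0 (sub_pos.2 h1).le]
      · rw [abs_of_neg (sub_neg.2 h1), abs_of_pos (sub_pos.2 h2)]
        have := hint s x s' hs hs' h1 h2
        rw [abs_le] at this ⊢
        constructor <;> nlinarith
      · rw [abs_of_pos (sub_pos.2 h1), abs_of_neg (sub_neg.2 h2)]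
        have := hint s' x s hs' hs h2 h1
        rw [abs_le] at this ⊢
        constructor <;> nlinarith
      · rw [abs_of_pos (sub_pos.2 h1), abs_of_pos (sub_pos.2 h2)]
        rcases lt_trichotomy s s' with h3 | rfl | h3
        · have := hint x s s' hx hs' h1 h3
          rw [abs_le] at this ⊢
          constructor <;> nlinarith [mul_nonneg hw0 (sub_pos.2 h1).le]
        · rw [sub_self, abs_zero]; nlinarith [mul_nonneg hw0 (sub_pos.2 h2).le]
        · have := hint x s' s hx hs h2 h3
          rw [abs_le] at this ⊢
          constructor <;> nlinarith [mul_nonneg hw0 (sub_pos.2 h2).le]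
    have e1 : s - x ≠ 0 := sub_ne_zero.2 hsx
    have e2 : s' - x ≠ 0 := sub_ne_zero.2 hsx'
    have p1 : 0 < |s - x| := abs_pos.2 e1
    have p2 : 0 < |s' - x| := abs_pos.2 e2
    have : |(g s - g x) / (s - x) - (g s' - g x) / (s' - x)| ≤ w / |s - x| + w / |s' - x| := by
      rw [div_sub_div _ _ e1 e2, abs_div, abs_mul, div_add_div _ _ p1.ne' p2.ne']
      rw [mul_comm (s - x)]
      gcongr
      linarith
    simp only [hl, hr]
    linarith [(abs_le.1 this).2]
  by_cases hne : ∃ s ∈ Icc a b, s ≠ x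
  · obtain ⟨s₀, hs₀, hs₀x⟩ := hne
    have hbdd : BddAbove (l '' {s | s ∈ Icc a b ∧ s ≠ x}) :=
      ⟨r s₀, by rintro _ ⟨s, hs, rfl⟩; exact key s hs.1 hs.2 s₀ hs₀ hs₀x⟩
    refine ⟨sSup (l '' {s | s ∈ Icc a b ∧ s ≠ x}), fun s hs => ?_⟩
    by_cases hsx : s = x
    · simpa [hsx] using hw0
    have h1 : l s ≤ sSup (l '' {s | s ∈ Icc a b ∧ s ≠ x}) :=
      le_csSup hbdd ⟨s, ⟨hs, hsx⟩, rfl⟩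
    have h2 : sSup (l '' {s | s ∈ Icc a b ∧ s ≠ x}) ≤ r s :=
      csSup_le ⟨_, s₀, ⟨hs₀, hs₀x⟩, rfl⟩
        (by rintro _ ⟨s', hs', rfl⟩; exact key s' hs'.1 hs'.2 s hs hsx)
    set c := sSup (l '' {s | s ∈ Icc a b ∧ s ≠ x})
    have e1 : s - x ≠ 0 := sub_ne_zero.2 hsx
    have p1 : 0 < |s - x| := abs_pos.2 e1
    have h3 : |(g s - g x) / (s - x) - c| ≤ w / |s - x| := by
      rw [abs_le]
      simp only [hl, hr] at h1 h2
      constructor <;> linarith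
    rw [le_div_iff₀ p1, ← abs_mul, sub_mul, div_mul_cancel₀ _ e1] at h3
    exact h3
  · push Not at hne
    exact ⟨0, fun s hs => by simpa [hne s hs] using hw0⟩

/-! ### Moduli of smoothness and the slopes they control -/

theorem exists_abs_le_of_continuousOn {g : ℝ → ℝ} (hg : ContinuousOn g (Icc (0 : ℝ) 1)) :
    ∃ M : ℝ, ∀ t ∈ Icc (0 : ℝ) 1, |g t| ≤ M :=
  isCompact_Icc.exists_bound_of_continuousOn hg

theorem abs_sub_le_omega1 {g : ℝ → ℝ} (hg : ContinuousOn g (Icc (0 : ℝ) 1)) {δ s t : ℝ}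
    (hs : s ∈ Icc (0 : ℝ) 1) (ht : t ∈ Icc (0 : ℝ) 1) (hst : |s - t| ≤ δ) :
    |g s - g t| ≤ omega1 g δ := by
  obtain ⟨M, hM⟩ := exists_abs_le_of_continuousOn hg
  refine le_csSup ⟨M + M, ?_⟩ ⟨s, hs, t, ht, hst, rfl⟩
  rintro _ ⟨s, hs, t, ht, -, rfl⟩
  exact (abs_sub _ _).trans (add_le_add (hM s hs) (hM t ht))

theorem second_difference_le_omega2 {g : ℝ → ℝ} (hg : ContinuousOn g (Icc (0 : ℝ) 1))
    {δ t k : ℝ} (hk : |k| ≤ δ) (h1 : t - k ∈ Icc (0 : ℝ) 1) (h2 : t + k ∈ Icc (0 : ℝ) 1) :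
    |g (t + k) - 2 * g t + g (t - k)| ≤ omega2 g δ := by
  obtain ⟨M, hM⟩ := exists_abs_le_of_continuousOn hg
  have hb : BddAbove {r : ℝ | ∃ t h : ℝ, 0 ≤ h ∧ h ≤ δ ∧ t - h ∈ Icc (0 : ℝ) 1 ∧
      t + h ∈ Icc (0 : ℝ) 1 ∧ r = |g (t + h) - 2 * g t + g (t - h)|} := by
    refine ⟨4 * M, ?_⟩
    rintro _ ⟨t, h, h0, -, h1, h2, rfl⟩
    have m1 := abs_le.1 (hM _ h1)
    have m2 := abs_le.1 (hM _ h2)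
    have m3 := abs_le.1 (hM t ⟨by linarith [h1.1], by linarith [h2.2]⟩)
    rw [abs_le]; constructor <;> linarith
  rcases le_total 0 k with h0 | h0
  · exact le_csSup hb ⟨t, k, h0, (le_abs_self k).trans hk, h1, h2, rfl⟩
  · refine le_csSup hb ⟨t, -k, by linarith, (neg_le_abs k).trans hk, by simpa using h2,
      by simpa [← sub_eq_add_neg] using h1, ?_⟩
    rw [sub_neg_eq_add, ← sub_eq_add_neg]
    congr 1; ring

theorem omega1_mono {g : ℝ → ℝ} (hg : ContinuousOn g (Icc (0 : ℝ) 1)) {δ δ' : ℝ}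
    (h0 : 0 ≤ δ) (h : δ ≤ δ') : omega1 g δ ≤ omega1 g δ' := by
  refine csSup_le ⟨_, 0, by simp, 0, by simp, by simpa using h0, rfl⟩ ?_
  rintro _ ⟨s, hs, t, ht, hst, rfl⟩
  exact abs_sub_le_omega1 hg hs ht (hst.trans h)

theorem omega2_mono {g : ℝ → ℝ} (hg : ContinuousOn g (Icc (0 : ℝ) 1)) {δ δ' : ℝ}
    (h0 : 0 ≤ δ) (h : δ ≤ δ') : omega2 g δ ≤ omega2 g δ' := by
  refine csSup_le ⟨_, 0, 0, le_rfl, h0, by simp, by simp, rfl⟩ ?_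
  rintro _ ⟨t, k, hk0, hk, h1, h2, rfl⟩
  exact second_difference_le_omega2 hg ((abs_of_nonneg hk0).le.trans (hk.trans h)) h1 h2

theorem omega1_nonneg (g : ℝ → ℝ) (δ : ℝ) : 0 ≤ omega1 g δ := by
  apply Real.sSup_nonneg
  rintro _ ⟨s, -, t, -, -, rfl⟩
  exact abs_nonneg _

theorem omega2_nonneg (g : ℝ → ℝ) (δ : ℝ) : 0 ≤ omega2 g δ := by
  apply Real.sSup_nonneg
  rintro _ ⟨t, h, -, -, -, -, rfl⟩
  exact abs_nonneg _

theorem omega2_le_two_mul_omega1 {g : ℝ → ℝ} (hg : ContinuousOn g (Icc (0 : ℝ) 1)) (δ : ℝ) :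
    omega2 g δ ≤ 2 * omega1 g δ := by
  refine Real.sSup_le ?_ (by linarith [omega1_nonneg g δ])
  rintro _ ⟨t, k, hk0, hk, h1, h2, rfl⟩
  have ht : t ∈ Icc (0 : ℝ) 1 := ⟨by linarith [h1.1], by linarith [h2.2]⟩
  have e1 := abs_le.1 (abs_sub_le_omega1 hg (δ := δ) h2 ht (by simpa [abs_of_nonneg hk0] using hk))
  have e2 := abs_le.1 (abs_sub_le_omega1 hg (δ := δ) h1 ht (by simpa [abs_of_nonneg hk0] using hk))
  rw [abs_le]; constructor <;> linarith

theorem abs_le_supNorm {g : ℝ → ℝ} (hg : ContinuousOn g (Icc (0 : ℝ) 1)) {t : ℝ}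
    (ht : t ∈ Icc (0 : ℝ) 1) : |g t| ≤ supNorm g := by
  obtain ⟨M, hM⟩ := exists_abs_le_of_continuousOn hg
  exact le_csSup ⟨M, by rintro _ ⟨t, ht, rfl⟩; exact hM t ht⟩ ⟨t, ht, rfl⟩

/-- A slope that is good on a window reaching distance `h` from `x` on one side is bounded. -/
theorem abs_slope_mul_le {g : ℝ → ℝ} (hg : ContinuousOn g (Icc (0 : ℝ) 1)) {h w c x : ℝ}
    (h0 : 0 < h) (h1 : h ≤ 1 / 2) (hx : x ∈ Icc (0 : ℝ) 1)
    (hc : ∀ s ∈ Icc (0 : ℝ) 1, |s - x| ≤ h → |g s - g x - c * (s - x)| ≤ w) :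
    |c| * h ≤ omega1 g h + w := by
  have aux : ∀ s ∈ Icc (0 : ℝ) 1, |s - x| = h → |c| * h ≤ omega1 g h + w := by
    intro s hs hsx
    have e1 := abs_sub_le_omega1 hg hs hx hsx.le
    have e2 := hc s hs hsx.le
    rw [← hsx, ← abs_mul, hsx]
    rw [abs_le] at *
    constructor <;> linarith
  rcases le_total x (1 / 2) with h2 | h2
  · exact aux (x + h) ⟨by linarith [hx.1], by linarith⟩ (by simp [h0.le])
  · exact aux (x - h) ⟨by linarith, by linarith [hx.2]⟩ (by simp [h0.le])

/-- At step 1/2 the window is all of [0, 1], so no quadratic growth term is needed. This serves the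
case n = 1 of the Voronovskaya estimate. -/
theorem exists_slope_half {g : ℝ → ℝ} (hg : ContinuousOn g (Icc (0 : ℝ) 1)) {x : ℝ}
    (hx : x ∈ Icc (0 : ℝ) 1) :
    ∃ c : ℝ, |c| * (1 / 2) ≤ omega1 g (1 / 2) + omega2 g (1 / 2) ∧
      ∀ s ∈ Icc (0 : ℝ) 1, |g s - g x - c * (s - x)| ≤ omega2 g (1 / 2) := by
  obtain ⟨c, hc⟩ := exists_slope_of_second_difference (w := omega2 g (1 / 2)) hx hg
    (fun t k h1 h2 => second_difference_le_omega2 hg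
      (by rw [abs_le]; constructor <;> linarith [h1.1, h1.2, h2.1, h2.2]) h1 h2)
  exact ⟨c, abs_slope_mul_le hg (by norm_num) le_rfl hx fun s hs _ => hc s hs, hc⟩

theorem abs_le_of_second_difference_seq {v : ℕ → ℝ} {w : ℝ} {N : ℕ} (h0 : v 0 = 0)
    (h1 : |v 1| ≤ w)
    (h2 : ∀ j, j + 2 ≤ N → |v (j + 2) - 2 * v (j + 1) + v j| ≤ w) :
    |v N| ≤ w * (N * (N + 1) / 2) := by
  have hw : 0 ≤ w := (abs_nonneg _).trans h1
  have step : ∀ j, j + 1 ≤ N → |v (j + 1) - v j| ≤ w * (j + 1) := by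
    intro j
    induction j with
    | zero => intro _; simpa [h0] using h1
    | succ j ih =>
      intro hj
      have e1 := abs_le.1 (ih (by omega))
      have e2 := abs_le.1 (h2 j (by omega))
      push_cast
      rw [abs_le]; constructor <;> linarith
  have main : ∀ j ≤ N, |v j| ≤ w * (j * (j + 1) / 2) := by
    intro j
    induction j with
    | zero => intro _; simp [h0]
    | succ j ih =>
      intro hj
      have e1 := abs_le.1 (ih (by omega))
      have e2 := abs_le.1 (step j hj)
      push_cast
      rw [abs_le]; constructor <;> linarith
  exact main N le_rfl

/-- The slope is fitted within distance h of x. A farther s is reached from x by N equal steps of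
length at most h; summing second differences along them makes the error grow only quadratically. -/
theorem exists_slope {g : ℝ → ℝ} (hg : ContinuousOn g (Icc (0 : ℝ) 1)) {h x : ℝ}
    (h0 : 0 < h) (h1 : h ≤ 1 / 2) (hx : x ∈ Icc (0 : ℝ) 1) :
    ∃ c : ℝ, |c| * h ≤ omega1 g h + omega2 g h ∧
      ∀ s ∈ Icc (0 : ℝ) 1,
        |g s - g x - c * (s - x)| ≤ omega2 g h * (1 + 3 / h ^ 2 * (s - x) ^ 2) := by
  have hsub : Icc (max 0 (x - h)) (min 1 (x + h)) ⊆ Icc (0 : ℝ) 1 :=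
    Icc_subset_Icc (le_max_left _ _) (min_le_left _ _)
  have hsub' : Icc (max 0 (x - h)) (min 1 (x + h)) ⊆ Icc (x - h) (x + h) :=
    Icc_subset_Icc (le_max_right _ _) (min_le_right _ _)
  obtain ⟨c, hc⟩ := exists_slope_of_second_difference (g := g) (w := omega2 g h) (x := x)
    (a := max 0 (x - h)) (b := min 1 (x + h))
    ⟨max_le hx.1 (by linarith), le_min hx.2 (by linarith)⟩ (hg.mono hsub)
    (fun t k k1 k2 => second_difference_le_omega2 hg (by
      have := hsub' k1
      have := hsub' k2
      simp only [mem_Icc] at *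
      rw [abs_le]; constructor <;> linarith) (hsub k1) (hsub k2))
  have hc' : ∀ s ∈ Icc (0 : ℝ) 1, |s - x| ≤ h → |g s - g x - c * (s - x)| ≤ omega2 g h := by
    intro s hs hsx
    rw [abs_le] at hsx
    exact hc s ⟨max_le hs.1 (by linarith), le_min hs.2 (by linarith)⟩
  refine ⟨c, abs_slope_mul_le hg h0 h1 hx hc', fun s hs => ?_⟩
  set u := |s - x| / h with hu
  have hu0 : 0 ≤ u := by positivity
  have hu2 : 3 / h ^ 2 * (s - x) ^ 2 = 3 * u ^ 2 := by
    rw [hu, div_pow, sq_abs]; ring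
  rw [hu2]
  have hw := omega2_nonneg g h
  rcases le_or_gt u 1 with hu1 | hu1
  · have := hc' s hs (by rwa [hu, div_le_one h0] at hu1)
    nlinarith [mul_nonneg hw (sq_nonneg u)]
  set N := ⌈u⌉₊ with hN
  have hN1 : u ≤ N := Nat.le_ceil u
  have hN2 : (N : ℝ) < u + 1 := Nat.ceil_lt_add_one hu0
  have hN0 : (1 : ℝ) < N := hu1.trans_le hN1
  set d := (s - x) / N with hd
  have hNd : N * d = s - x := by rw [hd]; field_simp
  have hdh : |d| ≤ h := by
    rw [hd, abs_div, Nat.abs_cast, div_le_iff₀ (by linarith), mul_comm]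
    rwa [hu, div_le_iff₀ h0] at hN1
  have hmem : ∀ j : ℕ, j ≤ N → x + j * d ∈ Icc (0 : ℝ) 1 := by
    intro j hj
    have hjN : (j : ℝ) / N ≤ 1 := by
      rw [div_le_one (by linarith)]; exact_mod_cast hj
    have hjN0 : 0 ≤ (j : ℝ) / N := by positivity
    have : x + j * d = (1 - j / N) * x + (j / N) * s := by rw [hd]; field_simp; ring
    rw [this]
    exact convex_Icc (0 : ℝ) 1 hx hs (by linarith) hjN0 (by ring)
  have hN1' : 1 ≤ N := by exact_mod_cast hN0.le
  have hseq := abs_le_of_second_difference_seq (N := N) (w := omega2 g h)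
    (v := fun j => g (x + j * d) - g x - c * (j * d)) (by simp)
    (by
      have := hc' _ (hmem 1 hN1') (by simpa using hdh)
      simpa using this)
    (by
      intro j hj
      have e := second_difference_le_omega2 hg hdh (t := x + (j + 1 : ℕ) * d)
        (by convert hmem j (by omega) using 1; push_cast; ring)
        (by convert hmem (j + 2) hj using 1; push_cast; ring)
      have r1 : x + (j + 1 : ℕ) * d + d = x + (j + 2 : ℕ) * d := by push_cast; ring
      have r2 : x + (j + 1 : ℕ) * d - d = x + j * d := by push_cast; ring
      rw [r1, r2] at e
      convert e using 2
      push_cast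
      ring)
  simp only [hNd, add_sub_cancel] at hseq
  refine hseq.trans (mul_le_mul_of_nonneg_left ?_ hw)
  -- N(N+1)/2 ≤ (u+1)(u+2)/2 ≤ 1 + 3u², since N < u + 1 and u > 1.
  nlinarith

/-! ### Convex comparison -/

theorem nonneg_of_second_deriv_nonneg {a b x : ℝ} (hx : x ∈ Icc a b) {ψ ψ' ψ'' : ℝ → ℝ}
    (h1 : ∀ t ∈ Icc a b, HasDerivWithinAt ψ (ψ' t) (Icc a b) t)
    (h2 : ∀ t ∈ Icc a b, HasDerivWithinAt ψ' (ψ'' t) (Icc a b) t)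
    (h3 : ∀ t ∈ Icc a b, 0 ≤ ψ'' t) (hψ' : ψ' x = 0) (hψ : ψ x = 0) :
    ∀ t ∈ Icc a b, 0 ≤ ψ t := by
  have hmono : MonotoneOn ψ' (Icc a b) := by
    refine monotoneOn_of_hasDerivWithinAt_nonneg (convex_Icc a b)
      (fun t ht => (h2 t ht).continuousWithinAt)
      (fun t ht => (h2 t (interior_subset ht)).mono interior_subset)
      (fun t ht => h3 t (interior_subset ht))
  intro t ht
  rcases le_total x t with h | h
  · have hs : Icc x t ⊆ Icc a b := Icc_subset_Icc hx.1 ht.2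
    have : MonotoneOn ψ (Icc x t) := by
      refine monotoneOn_of_hasDerivWithinAt_nonneg (convex_Icc x t)
        (fun y hy => ((h1 y (hs hy)).mono hs).continuousWithinAt)
        (fun y hy => (h1 y (hs (interior_subset hy))).mono (interior_subset.trans hs))
        (fun y hy => ?_)
      have hy' := interior_subset hy
      rw [← hψ']
      exact hmono hx (hs hy') hy'.1
    rw [← hψ]
    exact this (left_mem_Icc.2 h) (right_mem_Icc.2 h) h
  · have hs : Icc t x ⊆ Icc a b := Icc_subset_Icc ht.1 hx.2
    have : AntitoneOn ψ (Icc t x) := by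
      refine antitoneOn_of_hasDerivWithinAt_nonpos (convex_Icc t x)
        (fun y hy => ((h1 y (hs hy)).mono hs).continuousWithinAt)
        (fun y hy => (h1 y (hs (interior_subset hy))).mono (interior_subset.trans hs))
        (fun y hy => ?_)
      have hy' := interior_subset hy
      rw [← hψ']
      exact hmono (hs hy') hx hy'.2
    rw [← hψ]
    exact this (left_mem_Icc.2 h) (right_mem_Icc.2 h) h

/-! ### Binomial expectations and central moments -/

/-- The binomial expectation `∑_{k=0}^m p_{m,k}(x) φ(k)`. -/
noncomputable def bernsteinSum (m : ℕ) (x : ℝ) (φ : ℕ → ℝ) : ℝ :=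
  ∑ k ∈ Finset.range (m + 1), (bernsteinPolynomial ℝ m k).eval x * φ k

theorem bernsteinPolynomial_eval_nonneg {x : ℝ} (hx : x ∈ Icc (0 : ℝ) 1) (m k : ℕ) :
    0 ≤ (bernsteinPolynomial ℝ m k).eval x := by
  have h1 : 0 ≤ 1 - x := by linarith [hx.2]
  have h0 := hx.1
  simp only [bernsteinPolynomial, Polynomial.eval_mul, Polynomial.eval_pow,
    Polynomial.eval_natCast, Polynomial.eval_X, Polynomial.eval_sub, Polynomial.eval_one]
  positivity

theorem bernsteinSum_sub (m : ℕ) (x : ℝ) (φ χ : ℕ → ℝ) :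
    bernsteinSum m x (fun k => φ k - χ k) = bernsteinSum m x φ - bernsteinSum m x χ := by
  simp [bernsteinSum, mul_sub, Finset.sum_sub_distrib]

theorem bernsteinSum_add (m : ℕ) (x : ℝ) (φ χ : ℕ → ℝ) :
    bernsteinSum m x (fun k => φ k + χ k) = bernsteinSum m x φ + bernsteinSum m x χ := by
  simp [bernsteinSum, mul_add, Finset.sum_add_distrib]

theorem bernsteinSum_const_mul (m : ℕ) (x c : ℝ) (φ : ℕ → ℝ) :
    bernsteinSum m x (fun k => c * φ k) = c * bernsteinSum m x φ := by
  simp only [bernsteinSum, Finset.mul_sum]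
  exact Finset.sum_congr rfl fun k _ => by ring

theorem abs_bernsteinSum_sub_le {x : ℝ} (hx : x ∈ Icc (0 : ℝ) 1) {m : ℕ} {φ χ ψ : ℕ → ℝ}
    (h : ∀ k ≤ m, |φ k - χ k| ≤ ψ k) :
    |bernsteinSum m x φ - bernsteinSum m x χ| ≤ bernsteinSum m x ψ := by
  rw [← bernsteinSum_sub]
  refine (Finset.abs_sum_le_sum_abs _ _).trans (Finset.sum_le_sum fun k hk => ?_)
  have h0 := bernsteinPolynomial_eval_nonneg hx m k
  rw [abs_mul, abs_of_nonneg h0]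
  exact mul_le_mul_of_nonneg_left (h k (by simpa [Nat.lt_succ_iff] using hk)) h0

theorem modBernstein_succ (a₀ a₁ : ℕ → ℝ) (m : ℕ) (f : ℝ → ℝ) (x : ℝ) :
    modBernstein a₀ a₁ (m + 1) f x = bernsteinSum m x (fun k =>
      perturbCoeff a₀ a₁ x (m + 1) * f ((k : ℝ) / (m + 1 : ℕ))
        + perturbCoeff a₀ a₁ (1 - x) (m + 1) * f (((k + 1 : ℕ) : ℝ) / (m + 1 : ℕ))) := by
  rw [bernsteinSum_add, bernsteinSum_const_mul, bernsteinSum_const_mul]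
  set A := perturbCoeff a₀ a₁ x (m + 1)
  set A' := perturbCoeff a₀ a₁ (1 - x) (m + 1)
  have e0 : (bernsteinPolynomial ℝ m 0).eval x = (1 - x) ^ m := by simp [bernsteinPolynomial]
  have em : (bernsteinPolynomial ℝ m m).eval x = x ^ m := by simp [bernsteinPolynomial]
  have emid : ∀ k ∈ Finset.range m,
      modBernsteinBasis a₀ a₁ (m + 1) (k + 1) x * f (((k + 1 : ℕ) : ℝ) / (m + 1 : ℕ))
      = A * ((bernsteinPolynomial ℝ m (k + 1)).eval x * f (((k + 1 : ℕ) : ℝ) / (m + 1 : ℕ)))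
        + A' * ((bernsteinPolynomial ℝ m k).eval x * f (((k + 1 : ℕ) : ℝ) / (m + 1 : ℕ))) := by
    intro k hk
    have hk' : k ≠ m := (Finset.mem_range.1 hk).ne
    simp only [modBernsteinBasis, Nat.add_eq_zero_iff, one_ne_zero, and_false, if_false,
      Nat.add_right_cancel_iff, hk', Nat.add_sub_cancel]
    ring
  rw [modBernstein, Finset.sum_range_succ, Finset.sum_range_succ', Finset.sum_congr rfl emid,
    Finset.sum_add_distrib, ← Finset.mul_sum, ← Finset.mul_sum]
  rw [bernsteinSum, bernsteinSum, Finset.sum_range_succ', Finset.sum_range_succ (fun k =>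
    (bernsteinPolynomial ℝ m k).eval x * f (((k + 1 : ℕ) : ℝ) / (m + 1 : ℕ))), e0, em]
  have b0 : modBernsteinBasis a₀ a₁ (m + 1) 0 x = A * (1 - x) ^ m := by
    simp [modBernsteinBasis, A]
  have b1 : modBernsteinBasis a₀ a₁ (m + 1) (m + 1) x = A' * x ^ m := by
    simp [modBernsteinBasis, A']
  rw [b0, b1]
  ring

theorem bernsteinSum_succ (m : ℕ) (x : ℝ) (φ : ℕ → ℝ) :
    bernsteinSum (m + 1) x φ = bernsteinSum m x (fun k => (1 - x) * φ k + x * φ (k + 1)) := by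
  have hrec : ∀ k, (bernsteinPolynomial ℝ (m + 1) (k + 1)).eval x
      = (1 - x) * (bernsteinPolynomial ℝ m (k + 1)).eval x
        + x * (bernsteinPolynomial ℝ m k).eval x := by
    intro k
    rcases lt_or_ge k m with h | h
    · obtain ⟨d, rfl⟩ := Nat.exists_eq_add_of_lt h
      have e1 : k + d + 1 + 1 - (k + 1) = d + 1 := by omega
      have e2 : k + d + 1 - (k + 1) = d := by omega
      have e3 : k + d + 1 - k = d + 1 := by omega
      simp only [bernsteinPolynomial, Polynomial.eval_mul, Polynomial.eval_pow,
        Polynomial.eval_natCast, Polynomial.eval_X, Polynomial.eval_sub, Polynomial.eval_one,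
        Nat.choose_succ_succ, e1, e2, e3, Nat.succ_eq_add_one]
      push_cast
      ring
    · rw [bernsteinPolynomial.eq_zero_of_lt ℝ (Nat.lt_succ_of_le h)]
      rcases h.eq_or_lt with rfl | h'
      · simp [bernsteinPolynomial, pow_succ, mul_comm]
      · rw [bernsteinPolynomial.eq_zero_of_lt ℝ h',
          bernsteinPolynomial.eq_zero_of_lt ℝ (Nat.succ_lt_succ h')]
        simp
  have e0 : (bernsteinPolynomial ℝ (m + 1) 0).eval x
      = (1 - x) * (bernsteinPolynomial ℝ m 0).eval x := by
    simp [bernsteinPolynomial, pow_succ, mul_comm]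
  rw [bernsteinSum_add, bernsteinSum_const_mul, bernsteinSum_const_mul]
  have ez : bernsteinSum m x φ = ∑ k ∈ Finset.range (m + 2),
      (bernsteinPolynomial ℝ m k).eval x * φ k := by
    rw [Finset.sum_range_succ, bernsteinPolynomial.eq_zero_of_lt ℝ (Nat.lt_succ_self m)]
    simp [bernsteinSum]
  rw [ez, bernsteinSum, Finset.sum_range_succ', Finset.sum_range_succ' _ (m + 1), e0]
  simp only [hrec, bernsteinSum, mul_add, add_mul, Finset.sum_add_distrib, Finset.mul_sum,
    mul_assoc]
  ring

/-- Averaging over one more Bernoulli trial maps centred quartics to centred quartics, so induction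
with free coefficients gives all the moments at once. -/
theorem bernsteinSum_quartic (m : ℕ) (x c₀ c₁ c₂ c₃ c₄ : ℝ) :
    bernsteinSum m x (fun k => c₀ + c₁ * (k - m * x) + c₂ * (k - m * x) ^ 2
      + c₃ * (k - m * x) ^ 3 + c₄ * (k - m * x) ^ 4)
    = c₀ + c₂ * (m * (x * (1 - x))) + c₃ * (m * (x * (1 - x)) * (1 - 2 * x))
      + c₄ * (3 * m ^ 2 * (x * (1 - x)) ^ 2 + m * (x * (1 - x)) * (1 - 6 * (x * (1 - x)))) := by
  induction m generalizing c₀ c₁ c₂ c₃ c₄ with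
  | zero => simp [bernsteinSum, bernsteinPolynomial]
  | succ m ih =>
    have := ih (c₀ + c₂ * (x * (1 - x)) + c₃ * (x * (1 - x) * (1 - 2 * x))
        + c₄ * (x * (1 - x) * (1 - 3 * (x * (1 - x)))))
      (c₁ + 3 * (x * (1 - x)) * c₃ + 4 * (x * (1 - x) * (1 - 2 * x)) * c₄)
      (c₂ + 6 * (x * (1 - x)) * c₄) c₃ c₄
    rw [bernsteinSum_succ]
    convert this using 1
    · congr 1
      funext k
      push_cast
      ring
    · push_cast
      ring

/-! ### Voronovskaya estimate from a slope -/

theorem hasDerivWithinAt_sub_pow (x : ℝ) (s : Set ℝ) (j : ℕ) (t : ℝ) :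
    HasDerivWithinAt (fun t => (t - x) ^ j) (j * (t - x) ^ (j - 1)) s t := by
  simpa using (((hasDerivAt_id t).sub_const x).fun_pow j).hasDerivWithinAt

/-- Voronovskaya estimate for Bernstein operators from a slope bound on `f''`. -/
theorem abs_bernstein_voronovskaya_le {f f' f'' : ℝ → ℝ} {x c w κ : ℝ}
    (h1 : ∀ t ∈ Icc (0 : ℝ) 1, HasDerivWithinAt f (f' t) (Icc 0 1) t)
    (h2 : ∀ t ∈ Icc (0 : ℝ) 1, HasDerivWithinAt f' (f'' t) (Icc 0 1) t)
    (hx : x ∈ Icc (0 : ℝ) 1)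
    (hc : ∀ s ∈ Icc (0 : ℝ) 1, |f'' s - f'' x - c * (s - x)| ≤ w * (1 + κ * (s - x) ^ 2))
    {n : ℕ} (hn : 1 ≤ n) :
    |n * (bernsteinSum n x (fun k => f (k / n)) - f x) - x * (1 - x) / 2 * f'' x|
      ≤ x * (1 - x) * (|c| * |1 - 2 * x| / (6 * n)
        + w * (1 / 2 + κ * (3 * (n - 2) * (x * (1 - x)) + 1) / (12 * n ^ 2))) := by
  have hn0 : (0 : ℝ) < n := by exact_mod_cast hn
  -- T'' is the fitted line and Q'' its error bound, so Q ± (f - T) is convex with a double zero at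
  -- x. Hence |f - T| ≤ Q.
  set T : ℝ → ℝ := fun t => f x + f' x * (t - x) + f'' x / 2 * (t - x) ^ 2
    + c / 6 * (t - x) ^ 3 with hT
  set T' : ℝ → ℝ := fun t => f' x + f'' x * (t - x) + c / 2 * (t - x) ^ 2 with hT'
  set T'' : ℝ → ℝ := fun t => f'' x + c * (t - x) with hT''
  set Q : ℝ → ℝ := fun t => w * ((t - x) ^ 2 / 2 + κ * (t - x) ^ 4 / 12) with hQ
  set Q' : ℝ → ℝ := fun t => w * ((t - x) + κ * (t - x) ^ 3 / 3) with hQ'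
  set Q'' : ℝ → ℝ := fun t => w * (1 + κ * (t - x) ^ 2) with hQ''
  have hpow := hasDerivWithinAt_sub_pow x (Icc 0 1)
  have p1 : ∀ t : ℝ, HasDerivWithinAt (fun t => t - x) 1 (Icc 0 1) t := fun t =>
    ((hasDerivAt_id t).sub_const x).hasDerivWithinAt
  have dT : ∀ t, HasDerivWithinAt T (T' t) (Icc 0 1) t := by
    intro t
    refine HasDerivWithinAt.congr_deriv (((((p1 t).const_mul (f' x)).const_add (f x)).add
      ((hpow 2 t).const_mul (f'' x / 2))).add ((hpow 3 t).const_mul (c / 6))) ?_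
    simp only [hT']; push_cast; ring
  have dT' : ∀ t, HasDerivWithinAt T' (T'' t) (Icc 0 1) t := by
    intro t
    refine HasDerivWithinAt.congr_deriv ((((p1 t).const_mul (f'' x)).const_add (f' x)).add
      ((hpow 2 t).const_mul (c / 2))) ?_
    simp only [hT'']; push_cast; ring
  have dQ : ∀ t, HasDerivWithinAt Q (Q' t) (Icc 0 1) t := by
    intro t
    refine HasDerivWithinAt.congr_deriv
      ((((hpow 2 t).div_const 2).add (((hpow 4 t).const_mul κ).div_const 12)).const_mul w) ?_
    simp only [hQ']; push_cast; ring
  have dQ' : ∀ t, HasDerivWithinAt Q' (Q'' t) (Icc 0 1) t := by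
    intro t
    refine HasDerivWithinAt.congr_deriv
      (((p1 t).add (((hpow 3 t).const_mul κ).div_const 3)).const_mul w) ?_
    simp only [hQ'']; push_cast; ring
  have up := nonneg_of_second_deriv_nonneg hx
    (fun t ht => ((dQ t).sub (h1 t ht)).add (dT t))
    (fun t ht => ((dQ' t).sub (h2 t ht)).add (dT' t))
    (fun t ht => by
      have := abs_le.1 (hc t ht)
      simp only [hQ'', hT'']; linarith [this.2])
    (by simp [hQ', hT']) (by simp [hQ, hT])
  have lo := nonneg_of_second_deriv_nonneg hx
    (fun t ht => ((dQ t).add (h1 t ht)).sub (dT t))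
    (fun t ht => ((dQ' t).add (h2 t ht)).sub (dT' t))
    (fun t ht => by
      have := abs_le.1 (hc t ht)
      simp only [hQ'', hT'']; linarith [this.1])
    (by simp [hQ', hT']) (by simp [hQ, hT])
  have hmem : ∀ k ≤ n, (k : ℝ) / n ∈ Icc (0 : ℝ) 1 := fun k hk =>
    ⟨by positivity, by rw [div_le_one hn0]; exact_mod_cast hk⟩
  have main := abs_bernsteinSum_sub_le hx (m := n) (φ := fun k => f (k / n))
    (χ := fun k => T (k / n)) (ψ := fun k => Q (k / n)) (fun k hk => by
      have e1 := up _ (hmem k hk)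
      have e2 := lo _ (hmem k hk)
      simp only [Pi.add_apply, Pi.sub_apply] at e1 e2
      rw [abs_le]; constructor <;> linarith)
  have eT : bernsteinSum n x (fun k => T (k / n)) = f x + f'' x / 2 * (x * (1 - x) / n)
      + c / 6 * (x * (1 - x) * (1 - 2 * x) / n ^ 2) := by
    convert bernsteinSum_quartic n x (f x) (f' x / n) (f'' x / 2 / n ^ 2) (c / 6 / n ^ 3) 0
      using 1
    · congr 1
      funext k
      simp only [hT]
      field_simp
      ring
    · field_simp
      ring
  have eQ : bernsteinSum n x (fun k => Q (k / n)) = x * (1 - x) / n *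
      (w * (1 / 2 + κ * (3 * (n - 2) * (x * (1 - x)) + 1) / (12 * n ^ 2))) := by
    convert bernsteinSum_quartic n x 0 0 (w / 2 / n ^ 2) 0 (w * κ / 12 / n ^ 4)
      using 1
    · congr 1
      funext k
      simp only [hQ]
      field_simp
      ring
    · field_simp
      ring
  rw [eT, eQ] at main
  set S := bernsteinSum n x (fun k => f (k / n))
  have hX : 0 ≤ x * (1 - x) := mul_nonneg hx.1 (by linarith [hx.2])
  have split : n * (S - f x) - x * (1 - x) / 2 * f'' x
      = n * (S - (f x + f'' x / 2 * (x * (1 - x) / n)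
        + c / 6 * (x * (1 - x) * (1 - 2 * x) / n ^ 2)))
        + x * (1 - x) * (c * (1 - 2 * x) / (6 * n)) := by
    field_simp
    ring
  rw [split]
  refine (abs_add_le _ _).trans ?_
  rw [abs_mul, abs_mul, abs_of_pos hn0, abs_of_nonneg hX, abs_div, abs_mul,
    abs_of_pos (by positivity : (0 : ℝ) < 6 * n)]
  have := mul_le_mul_of_nonneg_left main hn0.le
  have e : (n : ℝ) * (x * (1 - x) / n *
      (w * (1 / 2 + κ * (3 * (n - 2) * (x * (1 - x)) + 1) / (12 * n ^ 2))))
      = x * (1 - x) * (w * (1 / 2 + κ * (3 * (n - 2) * (x * (1 - x)) + 1) / (12 * n ^ 2))) := by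
    field_simp
  rw [e] at this
  linarith

/-! ### The derivative of the Bernstein polynomial -/

/-- The derivative `n ∑_k p_{n-1,k}(x) (f((k+1)/n) - f(k/n))` of the Bernstein polynomial. -/
noncomputable def bernsteinDeriv (m : ℕ) (f : ℝ → ℝ) (x : ℝ) : ℝ :=
  (m + 1 : ℕ) * bernsteinSum m x
    (fun k => f (((k + 1 : ℕ) : ℝ) / (m + 1 : ℕ)) - f ((k : ℝ) / (m + 1 : ℕ)))

theorem bernsteinSum_one (m : ℕ) (x c : ℝ) : bernsteinSum m x (fun _ => c) = c := by
  simpa using bernsteinSum_quartic m x c 0 0 0 0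

/-- `bernsteinDeriv` averages difference quotients of f, each within M of y by the mean value
inequality. -/
theorem abs_bernsteinDeriv_sub_le_of_forall {f f' : ℝ → ℝ} {x y M : ℝ}
    (h1 : ∀ t ∈ Icc (0 : ℝ) 1, HasDerivWithinAt f (f' t) (Icc 0 1) t)
    (hx : x ∈ Icc (0 : ℝ) 1) (hM : ∀ t ∈ Icc (0 : ℝ) 1, |f' t - y| ≤ M) (m : ℕ) :
    |bernsteinDeriv m f x - y| ≤ M := by
  have hm : (0 : ℝ) < (m + 1 : ℕ) := by positivity
  have main := abs_bernsteinSum_sub_le hx (m := m)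
    (φ := fun k => f (((k + 1 : ℕ) : ℝ) / (m + 1 : ℕ)) - f ((k : ℝ) / (m + 1 : ℕ)))
    (χ := fun _ => y / (m + 1 : ℕ)) (ψ := fun _ => M / (m + 1 : ℕ)) (fun k hk => by
      have e1 : ((k + 1 : ℕ) : ℝ) / (m + 1 : ℕ) ∈ Icc (0 : ℝ) 1 :=
        ⟨by positivity, by rw [div_le_one hm]; exact_mod_cast Nat.succ_le_succ hk⟩
      have e2 : (k : ℝ) / (m + 1 : ℕ) ∈ Icc (0 : ℝ) 1 :=
        ⟨by positivity, by rw [div_le_one hm]; exact_mod_cast hk.trans (Nat.le_succ m)⟩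
      have := (convex_Icc (0 : ℝ) 1).norm_image_sub_le_of_norm_hasDerivWithin_le
        (f := fun t => f t - y * t) (f' := fun t => f' t - y) (C := M)
        (fun t ht => by
          simpa using (h1 t ht).fun_sub ((hasDerivWithinAt_id t _).const_mul y)) hM e2 e1
      have e3 : ((k + 1 : ℕ) : ℝ) / (m + 1 : ℕ) - (k : ℝ) / (m + 1 : ℕ) = 1 / (m + 1 : ℕ) := by
        push_cast; ring
      rw [e3, Real.norm_eq_abs, Real.norm_eq_abs, abs_of_pos (by positivity : (0 : ℝ) <
        1 / (m + 1 : ℕ)), mul_one_div] at this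
      refine le_trans (le_of_eq ?_) this
      congr 1
      rw [sub_sub_sub_comm, ← mul_sub, e3]
      ring)
  rw [bernsteinSum_one, bernsteinSum_one] at main
  have := mul_le_mul_of_nonneg_left main hm.le
  rw [← abs_of_pos hm, ← abs_mul, abs_of_pos hm, mul_sub, mul_div_cancel₀ _ hm.ne',
    mul_div_cancel₀ _ hm.ne'] at this
  exact this

theorem abs_bernsteinDeriv_sub_le {f f' : ℝ → ℝ} {x c w κ : ℝ}
    (h1 : ∀ t ∈ Icc (0 : ℝ) 1, HasDerivWithinAt f (f' t) (Icc 0 1) t)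
    (hx : x ∈ Icc (0 : ℝ) 1)
    (hc : ∀ s ∈ Icc (0 : ℝ) 1, |f' s - f' x - c * (s - x)| ≤ w * (1 + κ * (s - x) ^ 2))
    (m : ℕ) :
    |bernsteinDeriv m f x - f' x| ≤ |c| * |1 - 2 * x| / (2 * (m + 1))
      + w * (1 + κ * ((m - 1) * (x * (1 - x)) + 1 / 3) / (m + 1) ^ 2) := by
  have hm : (0 : ℝ) < m + 1 := by positivity
  -- P' is the fitted line and Q' its error bound, so Q ± (f - P) is monotone and increments of f
  -- can be compared with those of P.
  set P : ℝ → ℝ := fun t => f' x * t + c / 2 * (t - x) ^ 2 with hP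
  set Q : ℝ → ℝ := fun t => w * (t + κ / 3 * (t - x) ^ 3) with hQ
  have p1 : ∀ t : ℝ, HasDerivWithinAt (fun t => t) 1 (Icc 0 1) t := fun t =>
    hasDerivWithinAt_id t _
  have hpow := hasDerivWithinAt_sub_pow x (Icc 0 1)
  have dP : ∀ t, HasDerivWithinAt P (f' x + c * (t - x)) (Icc 0 1) t := by
    intro t
    refine HasDerivWithinAt.congr_deriv
      (((p1 t).const_mul (f' x)).add ((hpow 2 t).const_mul (c / 2))) ?_
    push_cast; ring
  have dQ : ∀ t, HasDerivWithinAt Q (w * (1 + κ * (t - x) ^ 2)) (Icc 0 1) t := by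
    intro t
    refine HasDerivWithinAt.congr_deriv
      (((p1 t).add ((hpow 3 t).const_mul (κ / 3))).const_mul w) ?_
    push_cast; ring
  have mono : ∀ ψ ψ' : ℝ → ℝ, (∀ t ∈ Icc (0 : ℝ) 1, HasDerivWithinAt ψ (ψ' t) (Icc 0 1) t) →
      (∀ t ∈ Icc (0 : ℝ) 1, 0 ≤ ψ' t) → MonotoneOn ψ (Icc 0 1) := fun ψ ψ' hd hp =>
    monotoneOn_of_hasDerivWithinAt_nonneg (convex_Icc 0 1)
      (fun t ht => (hd t ht).continuousWithinAt)
      (fun t ht => (hd t (interior_subset ht)).mono interior_subset)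
      (fun t ht => hp t (interior_subset ht))
  have up := mono _ _ (fun t ht => ((dQ t).sub (h1 t ht)).add (dP t))
    (fun t ht => by linarith [(abs_le.1 (hc t ht)).2])
  have lo := mono _ _ (fun t ht => ((dQ t).add (h1 t ht)).sub (dP t))
    (fun t ht => by linarith [(abs_le.1 (hc t ht)).1])
  have main := abs_bernsteinSum_sub_le hx (m := m)
    (φ := fun k => f (((k + 1 : ℕ) : ℝ) / (m + 1 : ℕ)) - f ((k : ℝ) / (m + 1 : ℕ)))
    (χ := fun k => P (((k + 1 : ℕ) : ℝ) / (m + 1 : ℕ)) - P ((k : ℝ) / (m + 1 : ℕ)))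
    (ψ := fun k => Q (((k + 1 : ℕ) : ℝ) / (m + 1 : ℕ)) - Q ((k : ℝ) / (m + 1 : ℕ)))
    (fun k hk => by
      have hm' : (0 : ℝ) < (m + 1 : ℕ) := by positivity
      have e1 : ((k + 1 : ℕ) : ℝ) / (m + 1 : ℕ) ∈ Icc (0 : ℝ) 1 :=
        ⟨by positivity, by rw [div_le_one hm']; exact_mod_cast Nat.succ_le_succ hk⟩
      have e2 : (k : ℝ) / (m + 1 : ℕ) ∈ Icc (0 : ℝ) 1 :=
        ⟨by positivity, by rw [div_le_one hm']; exact_mod_cast hk.trans (Nat.le_succ m)⟩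
      have e3 : (k : ℝ) / (m + 1 : ℕ) ≤ ((k + 1 : ℕ) : ℝ) / (m + 1 : ℕ) := by
        gcongr; simp
      have u1 := up e2 e1 e3
      have u2 := lo e2 e1 e3
      simp only [Pi.add_apply, Pi.sub_apply] at u1 u2
      rw [abs_le]; constructor <;> linarith)
  have eP : bernsteinSum m x
      (fun k => P (((k + 1 : ℕ) : ℝ) / (m + 1 : ℕ)) - P ((k : ℝ) / (m + 1 : ℕ)))
      = (f' x + c * (1 - 2 * x) / (2 * (m + 1))) / (m + 1) := by
    convert bernsteinSum_quartic m x ((f' x + c * (1 - 2 * x) / (2 * (m + 1))) / (m + 1))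
      (c / (m + 1) ^ 2) 0 0 0 using 1
    · congr 1
      funext k
      simp only [hP]
      push_cast
      field_simp
      ring
    · ring
  have eQ : bernsteinSum m x
      (fun k => Q (((k + 1 : ℕ) : ℝ) / (m + 1 : ℕ)) - Q ((k : ℝ) / (m + 1 : ℕ)))
      = w * (1 + κ * ((m - 1) * (x * (1 - x)) + 1 / 3) / (m + 1) ^ 2) / (m + 1) := by
    convert bernsteinSum_quartic m x
      (w / (m + 1) * (1 + κ / 3 * (1 - 3 * (x * (1 - x))) / (m + 1) ^ 2))
      (w * κ / (m + 1) ^ 3 * (1 - 2 * x)) (w * κ / (m + 1) ^ 3) 0 0 using 1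
    · congr 1
      funext k
      simp only [hQ]
      push_cast
      field_simp
      ring
    · field_simp
      ring
  rw [eP, eQ] at main
  have := mul_le_mul_of_nonneg_left main hm.le
  rw [mul_div_cancel₀ _ hm.ne'] at this
  set S := bernsteinSum m x
    (fun k => f (((k + 1 : ℕ) : ℝ) / (m + 1 : ℕ)) - f ((k : ℝ) / (m + 1 : ℕ))) with hS
  have split : bernsteinDeriv m f x - f' x
      = (m + 1) * (S - (f' x + c * (1 - 2 * x) / (2 * (m + 1))) / (m + 1))
        + c * (1 - 2 * x) / (2 * (m + 1)) := by
    rw [bernsteinDeriv, ← hS]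
    push_cast
    field_simp
    ring
  rw [split]
  refine (abs_add_le _ _).trans ?_
  rw [abs_mul, abs_of_pos hm, abs_div, abs_mul, abs_of_pos (by positivity : (0 : ℝ) < 2 * (m + 1))]
  linarith

/-! ### Decomposition of the operator and the bounds by moduli -/

theorem modBernstein_eq (a₀ a₁ : ℕ → ℝ) (m : ℕ) (h : 2 * a₀ (m + 1) + a₁ (m + 1) = 1)
    (f : ℝ → ℝ) (x : ℝ) :
    ((m + 1 : ℕ) : ℝ) * modBernstein a₀ a₁ (m + 1) f x
      = (m + 1 : ℕ) * bernsteinSum (m + 1) x (fun k => f (k / (m + 1 : ℕ)))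
        + (1 - 2 * x) / 2 * (1 + a₁ (m + 1)) * bernsteinDeriv m f x := by
  have h0 : a₀ (m + 1) = (1 - a₁ (m + 1)) / 2 := by linarith
  rw [modBernstein_succ, bernsteinSum_succ, bernsteinDeriv, bernsteinSum_add, bernsteinSum_add,
    bernsteinSum_sub]
  simp only [bernsteinSum_const_mul, perturbCoeff, h0]
  ring

theorem abs_bernstein_voronovskaya_le_omega {f f' f'' : ℝ → ℝ} {x : ℝ}
    (h1 : ∀ t ∈ Icc (0 : ℝ) 1, HasDerivWithinAt f (f' t) (Icc 0 1) t)
    (h2 : ∀ t ∈ Icc (0 : ℝ) 1, HasDerivWithinAt f' (f'' t) (Icc 0 1) t)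
    (hc : ContinuousOn f'' (Icc 0 1)) (hx : x ∈ Icc (0 : ℝ) 1) {n : ℕ} (hn : 1 ≤ n)
    {X X' : ℝ} (hX : X = x * (1 - x)) (hX' : X' = 1 - 2 * x) :
    |n * (bernsteinSum n x (fun k => f (k / n)) - f x) - X / 2 * f'' x|
      ≤ X * (5 / 6 * (|X'| / √(3 * ((n : ℝ) - 2) * X + 1))
              * omega1 f'' (√((3 * ((n : ℝ) - 2) * X + 1) / (n : ℝ) ^ 2))
            + 13 / 16 * omega2 f'' (√((3 * ((n : ℝ) - 2) * X + 1) / (n : ℝ) ^ 2))) := by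
  have hX0 : 0 ≤ X := hX ▸ mul_nonneg hx.1 (by linarith [hx.2])
  have hX4 : X ≤ 1 / 4 := by rw [hX]; nlinarith [sq_nonneg (x - 1 / 2)]
  have hX'1 : |X'| ≤ 1 := by
    rw [hX', abs_le]; constructor <;> linarith [hx.1, hx.2]
  have hX'0 := abs_nonneg X'
  rcases hn.eq_or_lt with rfl | hn
  -- For n = 1 the step q = √(1-3X) lies in [1/2, 1], and may be too long for `exists_slope`.
  · obtain ⟨c, hc1, hc2⟩ := exists_slope_half hc hx
    have key := abs_bernstein_voronovskaya_le h1 h2 hx (w := omega2 f'' (1 / 2)) (κ := 0)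
      (by simpa using hc2) le_rfl
    rw [← hX, ← hX'] at key
    set q := √(3 * (((1 : ℕ) : ℝ) - 2) * X + 1) with hq
    have hδ : √((3 * (((1 : ℕ) : ℝ) - 2) * X + 1) / ((1 : ℕ) : ℝ) ^ 2) = q := by simp [hq]
    have hq1 : q ≤ 1 := Real.sqrt_le_iff.2 ⟨zero_le_one, by push_cast; linarith⟩
    have hq2 : 1 / 2 ≤ q := Real.le_sqrt_of_sq_le (by push_cast; linarith)
    rw [hδ]
    refine key.trans (mul_le_mul_of_nonneg_left ?_ hX0)
    have m1 := omega1_mono hc (by norm_num) hq2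
    have m2 := omega2_mono hc (by norm_num) hq2
    have m3 := omega2_le_two_mul_omega1 hc (1 / 2)
    have n2 := omega2_nonneg f'' (1 / 2)
    have n1 := omega1_nonneg f'' (1 / 2)
    have n3 := omega1_nonneg f'' q
    have d1 : |X'| ≤ |X'| / q := le_div_self hX'0 (by linarith) hq1
    have d2 : |X'| * omega1 f'' (1 / 2) ≤ |X'| / q * omega1 f'' q :=
      mul_le_mul d1 m1 n1 (by positivity)
    have d3 := mul_le_mul_of_nonneg_right hc1 hX'0
    have d4 := mul_le_mul_of_nonneg_right m3 hX'0
    have d5 := mul_le_mul_of_nonneg_right hX'1 n2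
    push_cast
    -- The slope gives |X'|(ω₁ + ω₂)/3. Turning all of this ω₂ into 2ω₁ would overrun 5/6, so most
    -- of it is absorbed in the slack 13/16 - 1/2.
    linarith
  · have hn2 : (2 : ℝ) ≤ n := by exact_mod_cast hn
    have hn0 : (0 : ℝ) < n := by linarith
    have hq0 : 0 < 3 * ((n : ℝ) - 2) * X + 1 := by
      have : 0 ≤ ((n : ℝ) - 2) * X := mul_nonneg (by linarith) hX0
      linarith
    set q := √(3 * ((n : ℝ) - 2) * X + 1) with hq
    have hqp : 0 < q := Real.sqrt_pos.2 hq0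
    have hqq : q ^ 2 = 3 * ((n : ℝ) - 2) * X + 1 := Real.sq_sqrt hq0.le
    have hδ : √((3 * ((n : ℝ) - 2) * X + 1) / (n : ℝ) ^ 2) = q / n := by
      rw [Real.sqrt_div hq0.le, Real.sqrt_sq hn0.le]
    rw [hδ]
    have hδ0 : 0 < q / n := div_pos hqp hn0
    -- As X ≤ 1/4, 4q² ≤ 3n - 2 ≤ n²; the last step is (n-1)(n-2) ≥ 0.
    have hδ1 : q / n ≤ 1 / 2 := by
      rw [div_le_div_iff₀ hn0 two_pos]
      refine le_of_sq_le_sq ?_ (by positivity)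
      have := mul_le_mul_of_nonneg_left hX4 (by linarith : (0 : ℝ) ≤ n - 2)
      nlinarith
    obtain ⟨c, hc1, hc2⟩ := exists_slope hc hδ0 hδ1 hx
    have key := abs_bernstein_voronovskaya_le h1 h2 hx hc2 hn.le
    rw [← hX, ← hX', ← hqq] at key
    refine key.trans (mul_le_mul_of_nonneg_left ?_ hX0)
    have e1 : 3 / (q / n) ^ 2 * q ^ 2 / (12 * (n : ℝ) ^ 2) = 1 / 4 := by
      field_simp; norm_num
    have e2 : |c| * |X'| / (6 * n) = (|c| * (q / n)) * (|X'| / q) / 6 := by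
      field_simp
    rw [e1, e2]
    have m3 := omega2_le_two_mul_omega1 hc (q / n)
    have n2 := omega2_nonneg f'' (q / n)
    have n1 := omega1_nonneg f'' (q / n)
    have d0 : 0 ≤ |X'| / q := by positivity
    have d3 := mul_le_mul_of_nonneg_right (hc1.trans (add_le_add_right m3 _)) d0
    have d4 := mul_nonneg d0 n1
    -- The slope costs (ω₁ + ω₂)/6 ≤ ω₁/2, times |X'|/q; the ω₂ coefficient is 1/2 + 1/4. Both fit
    -- under 5/6 and 13/16.
    linarith

theorem abs_bernsteinDeriv_sub_le_omega {f f' : ℝ → ℝ} {x : ℝ}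
    (h1 : ∀ t ∈ Icc (0 : ℝ) 1, HasDerivWithinAt f (f' t) (Icc 0 1) t)
    (hc : ContinuousOn f' (Icc 0 1)) (hx : x ∈ Icc (0 : ℝ) 1) (m : ℕ) :
    |bernsteinDeriv m f x - f' x| ≤ 13 / 4 * omega2 f' (1 / √((m + 1 : ℕ) : ℝ))
      + 1 / √((m + 1 : ℕ) : ℝ) * omega1 f' (1 / √((m + 1 : ℕ) : ℝ)) := by
  have hX0 : 0 ≤ x * (1 - x) := mul_nonneg hx.1 (by linarith [hx.2])
  have hX4 : x * (1 - x) ≤ 1 / 4 := by nlinarith [sq_nonneg (x - 1 / 2)]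
  have hX'1 : |1 - 2 * x| ≤ 1 := by
    rw [abs_le]; constructor <;> linarith [hx.1, hx.2]
  rcases Nat.eq_zero_or_pos m with rfl | hm
  · have := abs_bernsteinDeriv_sub_le_of_forall h1 hx (y := f' x) (M := omega1 f' 1)
      (fun t ht => abs_sub_le_omega1 hc ht hx
        (by rw [abs_le]; constructor <;> linarith [ht.1, ht.2, hx.1, hx.2])) 0
    have n2 := omega2_nonneg f' 1
    simp only [zero_add, Nat.cast_one, Real.sqrt_one, div_one, one_mul]
    linarith
  have hm1 : (1 : ℝ) ≤ m := by exact_mod_cast hm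
  have hm0 : (0 : ℝ) < m + 1 := by linarith
  push_cast
  set r := √((m : ℝ) + 1) with hr
  have hr0 : 0 < r := Real.sqrt_pos.2 hm0
  have hrr : r ^ 2 = m + 1 := Real.sq_sqrt hm0.le
  -- the step `1 / r`, truncated at `1 / 2`
  obtain ⟨h, hh0, hh1, hhr, hhm, hhc⟩ : ∃ h : ℝ, 0 < h ∧ h ≤ 1 / 2 ∧ h ≤ 1 / r ∧
      1 / (2 * (m + 1)) ≤ h * (1 / r) ∧
      3 / h ^ 2 * ((m - 1) * (x * (1 - x)) + 1 / 3) / ((m : ℝ) + 1) ^ 2 ≤ 1 := by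
    rcases le_or_gt 3 m with h3 | h3
    · have h3' : (3 : ℝ) ≤ m := by exact_mod_cast h3
      have h2r : 2 ≤ r := Real.le_sqrt_of_sq_le (by linarith)
      refine ⟨1 / r, by positivity, one_div_le_one_div_of_le two_pos h2r, le_rfl, ?_, ?_⟩
      · rw [div_mul_div_comm, one_mul, ← sq, hrr]
        exact one_div_le_one_div_of_le hm0 (by linarith)
      · rw [one_div, inv_pow, hrr, div_inv_eq_mul, div_le_iff₀ (by positivity)]
        have := mul_le_mul_of_nonneg_left hX4 (by linarith : (0 : ℝ) ≤ m - 1)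
        nlinarith
    · have h3' : (m : ℝ) ≤ 2 := by exact_mod_cast Nat.lt_succ_iff.1 h3
      have hr2 : r ≤ 2 := Real.sqrt_le_iff.2 ⟨by norm_num, by linarith⟩
      refine ⟨1 / 2, by norm_num, le_rfl, one_div_le_one_div_of_le hr0 hr2, ?_, ?_⟩
      · rw [div_mul_div_comm, one_mul]
        refine one_div_le_one_div_of_le (by positivity) ?_
        have : 1 ≤ r := Real.one_le_sqrt.2 (by linarith)
        nlinarith
      · rw [div_le_iff₀ (by positivity)]
        have := mul_le_mul_of_nonneg_left hX4 (by linarith : (0 : ℝ) ≤ m - 1)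
        nlinarith
  obtain ⟨c, hc1, hc2⟩ := exists_slope hc hh0 hh1 hx
  have key := abs_bernsteinDeriv_sub_le h1 hx hc2 m
  refine key.trans ?_
  have hrp : 0 < 1 / r := by positivity
  have m1 := omega1_mono hc hh0.le hhr
  have m2 := omega2_mono hc hh0.le hhr
  have n2 := omega2_nonneg f' h
  have hr1 : 1 / r ≤ 1 := by
    rw [div_le_one hr0]; exact Real.one_le_sqrt.2 (by linarith)
  have e1 : |c| * |1 - 2 * x| / (2 * (m + 1)) ≤ (|c| * h) * (1 / r) := by
    rw [mul_div_assoc, mul_assoc]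
    refine mul_le_mul_of_nonneg_left (le_trans ?_ hhm) (abs_nonneg c)
    gcongr
  have e2 := mul_le_mul_of_nonneg_right hc1 hrp.le
  have e3 := mul_le_mul_of_nonneg_right hr1 n2
  have e4 := mul_le_mul_of_nonneg_left m1 hrp.le
  have e5 := mul_le_mul_of_nonneg_left hhc n2
  have n3 := omega2_nonneg f' (1 / r)
  rw [mul_add (omega2 f' h), mul_one]
  -- The ω₂ coefficient is at most 1 + 1 + 1/r ≤ 3: constant error, quadratic growth, slope.
  linarith

theorem mainTheorem3 (a₀ a₁ : ℕ → ℝ) (L₁ : ℝ)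
    (ha : ∀ n : ℕ, 1 ≤ n → 2 * a₀ n + a₁ n = 1)
    (hL : Tendsto a₁ atTop (𝓝 L₁))
    (f : ℝ → ℝ) (hf : ContDiffOn ℝ 2 f (Icc (0 : ℝ) 1))
    (f' f'' : ℝ → ℝ)
    (hf' : f' = derivWithin f (Icc (0 : ℝ) 1))
    (hf'' : f'' = iteratedDerivWithin 2 f (Icc (0 : ℝ) 1))
    (n : ℕ) (hn : 1 ≤ n) (x : ℝ) (hx : x ∈ Icc (0 : ℝ) 1)
    (X X' : ℝ) (hX : X = x * (1 - x)) (hX' : X' = 1 - 2 * x) :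
    |(n : ℝ) * (modBernstein a₀ a₁ n f x - f x) - X / 2 * f'' x - X' / 2 * (1 + L₁) * f' x|
      ≤ X * (5 / 6 * (|X'| / √(3 * ((n : ℝ) - 2) * X + 1))
              * omega1 f'' (√((3 * ((n : ℝ) - 2) * X + 1) / (n : ℝ) ^ 2))
            + 13 / 16 * omega2 f'' (√((3 * ((n : ℝ) - 2) * X + 1) / (n : ℝ) ^ 2)))
        + |X'| / 2 * (|L₁ - a₁ n| * supNorm f'
            + |1 + L₁| * (13 / 4 * omega2 f' (1 / √(n : ℝ))
                + 1 / √(n : ℝ) * omega1 f' (1 / √(n : ℝ)))) := by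
  have hu : UniqueDiffOn ℝ (Icc (0 : ℝ) 1) := uniqueDiffOn_Icc zero_lt_one
  have h1 : ∀ t ∈ Icc (0 : ℝ) 1, HasDerivWithinAt f (f' t) (Icc 0 1) t := fun t ht => by
    rw [hf']
    exact (hf.differentiableOn (by norm_num) t ht).hasDerivWithinAt
  have e1 : iteratedDerivWithin 1 f (Icc (0 : ℝ) 1) = f' := by
    rw [hf']; exact iteratedDerivWithin_one
  have h2 : ∀ t ∈ Icc (0 : ℝ) 1, HasDerivWithinAt f' (f'' t) (Icc 0 1) t := fun t ht => by
    have hd := hf.differentiableOn_iteratedDerivWithin (m := 1) (by norm_num) hu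
    rw [e1] at hd
    have := (hd t ht).hasDerivWithinAt
    rwa [hf'', iteratedDerivWithin_succ, e1]
  have c1 : ContinuousOn f' (Icc 0 1) := fun t ht => (h2 t ht).continuousWithinAt
  have c2 : ContinuousOn f'' (Icc 0 1) := by
    rw [hf'']; exact hf.continuousOn_iteratedDerivWithin le_rfl hu
  obtain ⟨m, rfl⟩ : ∃ m, n = m + 1 := ⟨n - 1, by omega⟩
  have main1 := abs_bernstein_voronovskaya_le_omega h1 h2 c2 hx hn hX hX'
  have main2 := abs_bernsteinDeriv_sub_le_omega h1 c1 hx m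
  have main3 : |bernsteinDeriv m f x| ≤ supNorm f' := by
    simpa using abs_bernsteinDeriv_sub_le_of_forall h1 hx (y := 0)
      (fun t ht => by simpa using abs_le_supNorm c1 ht) m
  -- (1+a₁)D - (1+L₁)f'(x) = (a₁-L₁)D + (1+L₁)(D - f'(x)), with D the Bernstein derivative.
  have split : ((m + 1 : ℕ) : ℝ) * (modBernstein a₀ a₁ (m + 1) f x - f x) - X / 2 * f'' x
        - X' / 2 * (1 + L₁) * f' x
      = ((m + 1 : ℕ) * (bernsteinSum (m + 1) x (fun k => f (k / (m + 1 : ℕ))) - f x)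
          - X / 2 * f'' x)
        + X' / 2 * ((a₁ (m + 1) - L₁) * bernsteinDeriv m f x
          + (1 + L₁) * (bernsteinDeriv m f x - f' x)) := by
    rw [mul_sub, modBernstein_eq a₀ a₁ m (ha _ hn), hX']
    ring
  rw [split]
  refine (abs_add_le _ _).trans (add_le_add main1 ?_)
  rw [abs_mul, abs_div, abs_two]
  refine mul_le_mul_of_nonneg_left ((abs_add_le _ _).trans (add_le_add ?_ ?_)) (by positivity)
  · rw [abs_mul, abs_sub_comm]
    exact mul_le_mul_of_nonneg_left main3 (abs_nonneg _)
  · rw [abs_mul]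
    exact mul_le_mul_of_nonneg_left main2 (abs_nonneg _)
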